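/- Let $G=F_n\times A$, where $F_n$ is a free group of finite rank $n$ and $A$ is a finitely generated abelian group (written additively), and let $\pi\colon G\to F_n$ be the projection. Elements of $G$ are written $w\,t^{a}$ with $w\in F_n$, $a\in A$; row vectors and right actions are used throughout. Let $H_1,H_2\leqslant G$ be finitely generated subgroups such that $(H_1\cap H_2)\pi$ is nontrivial, and put $L_i=H_i\cap A$ for $i=1,2$. **Notation.** A *basis* of $H_i$ is a generating set $\{u_{i,1}t^{a_{i,1}},\dots,u_{i,p_i}t^{a_{i,p_i}};\,t^{b_{i,1}},\dots,t^{b_{i,q_i}}\}$ of $H_i$ such that $u_{i,1},\dots,u_{i,p_i}$ is a free basis of $H_i\pi$ and $b_{i,1},\dots,b_{i,q_i}$ is a generating set of $L_i$ of the smallest possible cardinality. Given finite bases of $H_1$ and $H_2$ and a free basis $\mathcal{B}=\{w_1,\dots,w_r\}$ of $H_1\pi\cap H_2\pi$, let $B_i$ be the $r\times p_i$ integer matrix whose $j$-th row is the abelianization in $\mathbb{Z}^{p_i}$ of the expression of $w_j$ in the basis $u_{i,1},\dots,u_{i,p_i}$; let $A_i$ be the matrix with rows $a_{i,1},\dots,a_{i,p_i}\in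 A$; let $D=B_1A_1-B_2A_2$, regarded as a homomorphism $\mathbb{Z}^r\to A$; and let $(L_1+L_2)D^{-1}=\{v\in\mathbb{Z}^r : vD\in L_1+L_2\}$. A *Smith decomposition* of a subgroup of $\mathbb{Z}^r$ consists of an integer $s\times r$ matrix $M$ whose rows form a basis of the subgroup, matrices $P\in GL_s(\mathbb{Z})$ and $Q\in GL_r(\mathbb{Z})$, and integers $\delta_1,\dots,\delta_r$, such that $PMQ=S$ is the $s\times r$ diagonal matrix $\mathrm{diag}(\delta_1,\dots,\delta_s)$, where $\delta_1,\dots,\delta_s$ are nonzero, $\delta_1\mid\cdots\mid\delta_s$, and $\delta_i=0$ for $s<i\leqslant r$. For a subgroup $K$ of a free group $F$ with free basis $\mathcal{B}=\{w_1,\dots,w_r\}$, the *Schreier automaton* of $K$ has the right cosets $Ku$ ($u\in F$) as vertices, an arc $Ku\to Kuw_j$ labelled $w_j$ for every coset $Ku$ and every $j$, and basepoint $K$. Its *core* is the subautomaton induced on the vertices that appear in some closed walk at the basepoint without backtracking (arcs may be crossed in both directions), and is called the *Stallings automaton* $\mathrm{St}(K,\mathcal{B})$. The *Cayley multidigraph*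 $\mathrm{Cay}(C,(h_j)_{1\leqslant j\leqslant r})$ of a group $C$ with respect to a finite family $(h_j)$ of generators (repetitions and trivial elements allowed) has vertex set $C$, an arc $g\to gh_j$ with label $h_j$ (recorded through its index $j$) for every $g\in C$ and every $j$, and the trivial element as basepoint. **Theorem.** The groups $H_1$ and $H_2$ have finite bases, and $H_1\pi\cap H_2\pi$ has a finite free basis. For every choice of finite bases of $H_1$ and $H_2$ and every free basis $\mathcal{B}=\{w_1,\dots,w_r\}$ of $H_1\pi\cap H_2\pi$, the subgroup $(L_1+L_2)D^{-1}$ of $\mathbb{Z}^r$ has a Smith decomposition; and for every Smith decomposition of it, the rows $e_1Q,\dots,e_rQ$ of $Q$, read in $\bigoplus_{i=1}^r\mathbb{Z}/\delta_i\mathbb{Z}$, generate this group, and $$\mathrm{St}\bigl((H_1\cap H_2)\pi,\ \mathcal{B}\bigr)\;\cong\;\mathrm{Cay}\Bigl(\bigoplus_{i=1}^r\mathbb{Z}/\delta_i\mathbb{Z},\ (e_jQ)_{j=1,\dots,r}\Bigr),$$ where $(H_1\cap H_2)\pi$ is regarded as a subgroup of the free group $H_1\pi\cap H_2\pi$. The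 isomorphism is one of pointed labelled multidigraphs: it respects basepoints, and it matches arcs labelled $w_j$ with arcs labelled $e_jQ$. -/

import Mathlib

/-! ### Automata -/

/-- An (involutive, pointed) `X`-automaton, given by its positive part: a set of vertices, a set of
arcs (parallel arcs and loops are allowed) with labels in `X`, and a basepoint.  Every arc can also
be crossed backwards, so the arcs of the involutive automaton are the pairs `(e, b) : Arc × Bool`,
where `(e, true)` is `e` crossed forwards, reading `label e`, and `(e, false)` is its inverse arc,
reading the inverse letter. -/
structure XAutomaton (X : Type*) where
  Vertex : Type*
  Arc : Type*
  source : Arc → Vertex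
  target : Arc → Vertex
  label : Arc → X
  base : Vertex

namespace XAutomaton

variable {X : Type*}

/-- The origin of a signed arc. -/
def signedSource (Γ : XAutomaton X) (e : Γ.Arc × Bool) : Γ.Vertex :=
  if e.2 then Γ.source e.1 else Γ.target e.1

/-- The end of a signed arc. -/
def signedTarget (Γ : XAutomaton X) (e : Γ.Arc × Bool) : Γ.Vertex :=
  if e.2 then Γ.target e.1 else Γ.source e.1

/-- `Γ.IsWalk p l q` : the list `l` of signed arcs is a walk from the vertex `p` to the
vertex `q`. -/
def IsWalk (Γ : XAutomaton X) : Γ.Vertex → List (Γ.Arc × Bool) → Γ.Vertex → Prop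
  | p, [], q => p = q
  | p, e :: l, q => Γ.signedSource e = p ∧ Γ.IsWalk (Γ.signedTarget e) l q

/-- A list of signed arcs is reduced if it has no two consecutive mutually inverse arcs. -/
def IsReducedWalk (Γ : XAutomaton X) (l : List (Γ.Arc × Bool)) : Prop :=
  l.IsChain (fun e f => f ≠ (e.1, !e.2))

/-- The vertex `p` appears in some reduced closed walk at the basepoint. -/
def IsCoreVertex (Γ : XAutomaton X) (p : Γ.Vertex) : Prop :=
  ∃ l₁ l₂ : List (Γ.Arc × Bool),
    Γ.IsWalk Γ.base l₁ p ∧ Γ.IsWalk p l₂ Γ.base ∧ Γ.IsReducedWalk (l₁ ++ l₂)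

theorem isCoreVertex_base (Γ : XAutomaton X) : Γ.IsCoreVertex Γ.base :=
  ⟨[], [], rfl, rfl, List.isChain_nil⟩

/-- The core of an automaton: the subautomaton induced on the vertices that appear in some reduced
closed walk at the basepoint.  It is the maximum subautomaton containing the basepoint in which
every vertex appears in a reduced closed walk at the basepoint. -/
def core (Γ : XAutomaton X) : XAutomaton X where
  Vertex := {p : Γ.Vertex // Γ.IsCoreVertex p}
  Arc := {e : Γ.Arc // Γ.IsCoreVertex (Γ.source e) ∧ Γ.IsCoreVertex (Γ.target e)}
  source e := ⟨Γ.source e.1, e.2.1⟩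
  target e := ⟨Γ.target e.1, e.2.2⟩
  label e := Γ.label e.1
  base := ⟨Γ.base, Γ.isCoreVertex_base⟩

/-- An isomorphism of `X`-automata: bijections between the vertices and between the arcs that
respect origins, ends, labels and the basepoint. -/
structure Iso (Γ Δ : XAutomaton X) where
  onVertex : Γ.Vertex ≃ Δ.Vertex
  onArc : Γ.Arc ≃ Δ.Arc
  map_source : ∀ e, Δ.source (onArc e) = onVertex (Γ.source e)
  map_target : ∀ e, Δ.target (onArc e) = onVertex (Γ.target e)
  map_label : ∀ e, Δ.label (onArc e) = Γ.label e
  map_base : onVertex Γ.base = Δ.base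

end XAutomaton

/-- Right multiplication by `g` on the set of right cosets of `H`: `Hu ↦ Hug`. -/
def rightCosetMul {G : Type*} [Group G] (H : Subgroup G) (g : G) :
    Quotient (QuotientGroup.rightRel H) → Quotient (QuotientGroup.rightRel H) :=
  Quotient.map (fun u => u * g) (by
    intro u v h
    have h' : v * u⁻¹ ∈ H := QuotientGroup.rightRel_apply.mp h
    exact QuotientGroup.rightRel_apply.mpr (by simpa [mul_assoc] using h'))

/-- The right Schreier automaton of a subgroup `H` of a free group `F` with basis `W`: its vertices
are the right cosets of `H`, with an arc `Hu → H u (W i)` for every coset `Hu` and every basis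
element `W i` (recorded by its index `i`), and basepoint `H`. -/
def schreierAutomaton {ι F : Type*} [Group F] (W : FreeGroupBasis ι F) (H : Subgroup F) :
    XAutomaton ι where
  Vertex := Quotient (QuotientGroup.rightRel H)
  Arc := Quotient (QuotientGroup.rightRel H) × ι
  source e := e.1
  target e := rightCosetMul H (W e.2) e.1
  label e := e.2
  base := Quotient.mk _ 1

/-- The Stallings automaton of a subgroup `H` of a free group with respect to the basis `W`: the core
of its Schreier automaton. -/
def stallingsAutomaton {ι F : Type*} [Group F] (W : FreeGroupBasis ι F) (H : Subgroup F) :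
    XAutomaton ι :=
  (schreierAutomaton W H).core

/-- The Cayley multidigraph of a group with respect to a family `h` of elements, repetitions and
the trivial element being allowed: an arc `g → g * h i` for every `g` and every index `i`, labelled
by (the index of) `h i`, and based at the trivial element. -/
def cayleyMultidigraph {ι G : Type*} [Group G] (h : ι → G) : XAutomaton ι where
  Vertex := G
  Arc := G × ι
  source e := e.1
  target e := e.1 * h e.2
  label e := e.2
  base := 1

/-! ### Free-times-abelian groups -/

/-- The group `F_n × A`, where `F_n` is the free group on `x_1, …, x_n`, and `A` is an additively
written abelian group. -/
abbrev FreeTimesAbelian (n : ℕ) (A : Type*) [AddCommGroup A] : Type _ :=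
  FreeGroup (Fin n) × Multiplicative A

namespace FreeTimesAbelian

variable {n : ℕ} {A : Type*} [AddCommGroup A]

/-- The projection `Hπ` of a subgroup `H` to the free part. -/
def proj (H : Subgroup (FreeTimesAbelian n A)) : Subgroup (FreeGroup (Fin n)) :=
  H.map (MonoidHom.fst (FreeGroup (Fin n)) (Multiplicative A))

/-- The subgroup `L_H = H ∩ A` of `A`. -/
def abPart (H : Subgroup (FreeTimesAbelian n A)) : AddSubgroup A :=
  Subgroup.toAddSubgroup' (H.comap (MonoidHom.inr (FreeGroup (Fin n)) (Multiplicative A)))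

/-- A finite basis `{u_1 t^{a_1}, …, u_p t^{a_p}; t^{b_1}, …, t^{b_q}}` of a subgroup `H`:
a generating set of `H` such that the `u_i` form a free-basis of `Hπ`, and the `b_j` form an
abelian-basis of `H ∩ A`, that is, a generating set of the smallest possible cardinal. -/
structure SubgroupBasis (H : Subgroup (FreeTimesAbelian n A)) where
  p : ℕ
  q : ℕ
  u : FreeGroupBasis (Fin p) (proj H)
  a : Fin p → A
  b : Fin q → A
  closure_eq : Subgroup.closure
    (Set.range (fun i => ((u i : FreeGroup (Fin n)), Multiplicative.ofAdd (a i))) ∪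
      Set.range (fun j => ((1 : FreeGroup (Fin n)), Multiplicative.ofAdd (b j)))) = H
  closure_b : AddSubgroup.closure (Set.range b) = abPart H
  minimal_b : ∀ T : Finset A, AddSubgroup.closure (T : Set A) = abPart H → q ≤ T.card

/-- The abelianization map `F_p → ℤ^p`. -/
def abelianize {p : ℕ} : FreeGroup (Fin p) →* Multiplicative (Fin p → ℤ) :=
  FreeGroup.lift (fun i => Multiplicative.ofAdd (Pi.single i 1))

/-- The integer matrix of the abelianization of the inclusion `K ≤ N` of free groups with bases `w`
and `u`: its `j`-th row is the abelianization of the expression of `w j` in the basis `u`. -/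
def inclusionMatrix {r p : ℕ} {K N : Subgroup (FreeGroup (Fin n))} (h : K ≤ N)
    (w : FreeGroupBasis (Fin r) K) (u : FreeGroupBasis (Fin p) N) :
    Matrix (Fin r) (Fin p) ℤ :=
  Matrix.of fun j => (abelianize (u.repr (Subgroup.inclusion h (w j)))).toAdd

variable {H₁ H₂ : Subgroup (FreeTimesAbelian n A)} {r : ℕ}

/-- The `j`-th row, an element of `A`, of the difference matrix `D = B₁ A₁ - B₂ A₂`, where `B_i` is
the matrix of the inclusion `H₁π ∩ H₂π ≤ H_iπ`, and the rows of `A_i` are the abelian parts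
`a_1, …, a_{p_i} ∈ A` of the chosen basis of `H_i`. -/
def diffRow (β₁ : SubgroupBasis H₁) (β₂ : SubgroupBasis H₂)
    (w : FreeGroupBasis (Fin r) ↥(proj H₁ ⊓ proj H₂)) (j : Fin r) : A :=
  (∑ k, inclusionMatrix inf_le_left w β₁.u j k • β₁.a k) -
    ∑ k, inclusionMatrix inf_le_right w β₂.u j k • β₂.a k

/-- The homomorphism `v ↦ v D` from `ℤ^r` to `A` defined by the difference matrix. -/
def diffHom (β₁ : SubgroupBasis H₁) (β₂ : SubgroupBasis H₂)
    (w : FreeGroupBasis (Fin r) ↥(proj H₁ ⊓ proj H₂)) : (Fin r → ℤ) →+ A where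
  toFun v := ∑ j, v j • diffRow β₁ β₂ w j
  map_zero' := by simp
  map_add' v v' := by simp [add_smul, Finset.sum_add_distrib]

/-- The subgroup `M = (L₁ + L₂) D⁻¹` of `ℤ^r` (full preimage), with `L_i = H_i ∩ A`. -/
def preimageLattice (β₁ : SubgroupBasis H₁) (β₂ : SubgroupBasis H₂)
    (w : FreeGroupBasis (Fin r) ↥(proj H₁ ⊓ proj H₂)) : AddSubgroup (Fin r → ℤ) :=
  (abPart H₁ ⊔ abPart H₂).comap (diffHom β₁ β₂ w)

end FreeTimesAbelian

/-- A Smith normal form decomposition for a subgroup `M` of `ℤ^r`: an integer `s × r` matrix `B`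
whose rows form a basis of `M`, and invertible integer matrices `P`, `Q` such that `P B Q` is the
Smith normal form `S = diag(δ_1, …, δ_s)`, with nonzero `δ_1 ∣ ⋯ ∣ δ_s`; moreover `δ_i = 0` for
`s < i ≤ r`. -/
structure SmithDecomposition {r : ℕ} (M : AddSubgroup (Fin r → ℤ)) where
  s : ℕ
  B : Matrix (Fin s) (Fin r) ℤ
  linearIndependent_rows : LinearIndependent ℤ B.row
  closure_rows : AddSubgroup.closure (Set.range B.row) = M
  P : GL (Fin s) ℤ
  Q : GL (Fin r) ℤ
  δ : Fin r → ℤ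
  eq_smith : (P : Matrix (Fin s) (Fin s) ℤ) * B * (Q : Matrix (Fin r) (Fin r) ℤ) =
    Matrix.of fun (i : Fin s) (j : Fin r) => if (i : ℕ) = (j : ℕ) then δ j else 0
  ne_zero_iff : ∀ i : Fin r, δ i ≠ 0 ↔ (i : ℕ) < s
  dvd_of_le : ∀ i j : Fin r, i ≤ j → δ i ∣ δ j

namespace SmithDecomposition

variable {r : ℕ} {M : AddSubgroup (Fin r → ℤ)}

/-- The direct sum of the (finitely many) groups `ℤ/δ_i ℤ`, `i = 1, …, r`. -/
abbrev cyclicSum (σ : SmithDecomposition M) : Type :=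
  (i : Fin r) → ℤ ⧸ AddSubgroup.zmultiples (σ.δ i)

/-- The `j`-th row `e_j Q` of `Q`, read in the direct sum of the groups `ℤ/δ_i ℤ`. -/
def rowQ (σ : SmithDecomposition M) (j : Fin r) : σ.cyclicSum :=
  fun i => QuotientAddGroup.mk ((σ.Q : Matrix (Fin r) (Fin r) ℤ) j i)

end SmithDecomposition

/-! For g in H₁π ∩ H₂π, the set of c with g t^c in H_i is a coset c_i(g) + L_i, where c_i(g) is the
abelianization of g in the basis of H_iπ, multiplied by A_i. So g lies in (H₁ ∩ H₂)π exactly when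
the two cosets meet, that is, when c₁(g) - c₂(g) ∈ L₁ + L₂. This difference is v D with v ∈ ℤ^r the
abelianization of g in the basis w (`mem_proj_inf_iff`). Hence (H₁ ∩ H₂)π is the kernel of the
surjection from H₁π ∩ H₂π through ℤ^r onto ℤ^r/(L₁ + L₂)D⁻¹, and v ↦ v Q identifies this quotient
with ⊕ ℤ/δ_i (`mem_iff_dvd`).

The Schreier automaton of a kernel is the Cayley multidigraph of the image (`schreierIsoCayley`).
Since the kernel is normal and nontrivial, every word extends to a reduced word in it
(`exists_isReduced_append`), so every vertex is in the core and the Stallings automaton is the whole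
Schreier automaton.

Existence of the data rests on Howson's theorem (`fg_inf`), on A being noetherian, and on the Smith
normal form (`Submodule.exists_basis_mem_iff_dvd`). -/

theorem List.prefix_append_cases {α : Type*} {L A B : List α} (h : L <+: A ++ B) :
    L <+: A ∨ ∃ C, L = A ++ C ∧ C <+: B := by
  obtain ⟨R, hR⟩ := h
  rcases List.append_eq_append_iff.mp hR with ⟨C, h₁, _⟩ | ⟨C, h₁, h₂⟩
  · exact Or.inl ⟨C, h₁.symm⟩
  · exact Or.inr ⟨C, h₁, R, h₂.symm⟩

/-! ### Howson's theorem -/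

namespace FreeGroup

variable {X : Type*}

/-- A prefix reaching past a cancelled pair becomes, with the pair reinserted, a prefix of the
longer word that represents the same element. -/
theorem prefix_property_of_red {P : FreeGroup X → Prop} {L L' : List (X × Bool)}
    (h : Red L L') (hL : ∀ L₁, L₁ <+: L → P (mk L₁)) : ∀ L₁, L₁ <+: L' → P (mk L₁) := by
  induction h with
  | refl => exact hL
  | tail _ hstep ih =>
    intro L₁ h₁
    cases hstep with
    | @not A B x b =>
      rcases List.prefix_append_cases h₁ with h | ⟨C, rfl, hC⟩
      · exact ih _ (h.trans (List.prefix_append _ _))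
      · have := ih (A ++ (x, b) :: (x, !b) :: C) (by
          rw [List.prefix_append_right_inj, List.cons_prefix_cons, List.cons_prefix_cons]
          exact ⟨rfl, rfl, hC⟩)
        rwa [show mk (A ++ (x, b) :: (x, !b) :: C) = mk (A ++ C) from
          Quot.sound Red.Step.not] at this

variable [DecidableEq X]

/-- Every prefix of the reduced word of an element of `H` lies in `H t` for some `t ∈ T`. -/
def PrefixBounded (H : Subgroup (FreeGroup X)) (T : Set (FreeGroup X)) : Prop :=
  ∀ h ∈ H, ∀ L, L <+: h.toWord → ∃ t ∈ T, mk L * t⁻¹ ∈ H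

/-- T consists of 1 and the prefixes of the generators: a walk reading a product of generators in
the coset graph only visits cosets of these. -/
theorem exists_prefixBounded_of_fg {H : Subgroup (FreeGroup X)} (hH : H.FG) :
    ∃ T : Set (FreeGroup X), T.Finite ∧ PrefixBounded H T := by
  obtain ⟨S, rfl⟩ := hH
  set H := Subgroup.closure (S : Set (FreeGroup X)) with hHdef
  refine ⟨{1} ∪ ⋃ s ∈ S, mk '' {L | L <+: s.toWord}, ?_, ?_⟩
  · refine (Set.finite_singleton _).union (S.finite_toSet.biUnion fun s _ => Set.Finite.image _ ?_)
    exact (List.finite_toSet s.toWord.inits).subset fun L hL => by simpa using hL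
  set T : Set (FreeGroup X) := {1} ∪ ⋃ s ∈ S, mk '' {L | L <+: s.toWord} with hT
  have h1T : (1 : FreeGroup X) ∈ T := Or.inl rfl
  -- Some word for h, not the reduced one: concatenation need not preserve reducedness. Reduction is
  -- applied only at the end.
  have key : ∀ h ∈ H, ∃ L, mk L = h ∧ ∀ L₁, L₁ <+: L → ∃ t ∈ T, mk L₁ * t⁻¹ ∈ H := by
    intro h hh
    induction hh using Subgroup.closure_induction with
    | mem s hs =>
      refine ⟨s.toWord, mk_toWord, fun L₁ h₁ => ⟨mk L₁, Or.inr ?_, by rw [mul_inv_cancel]; exact H.one_mem⟩⟩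
      exact Set.mem_biUnion hs ⟨L₁, h₁, rfl⟩
    | one =>
      refine ⟨[], rfl, fun L₁ h₁ => ⟨1, h1T, ?_⟩⟩
      rw [List.prefix_nil.mp h₁]
      simp [← one_eq_mk]
    | mul x y hx hy ihx ihy =>
      obtain ⟨L, rfl, hL⟩ := ihx
      obtain ⟨L', rfl, hL'⟩ := ihy
      refine ⟨L ++ L', by simp, fun L₁ h₁ => ?_⟩
      rcases List.prefix_append_cases h₁ with h | ⟨C, rfl, hC⟩
      · exact hL _ h
      · obtain ⟨t, ht, htH⟩ := hL' C hC
        refine ⟨t, ht, ?_⟩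
        rw [← mul_mk, mul_assoc]
        exact H.mul_mem hx htH
    | inv x hx ih =>
      obtain ⟨L, rfl, hL⟩ := ih
      refine ⟨invRev L, by simp, fun L₁ ⟨L₂, h₁⟩ => ?_⟩
      have h₂ : L = invRev L₂ ++ invRev L₁ := by
        rw [← invRev_append, h₁, invRev_invRev]
      obtain ⟨t, ht, htH⟩ := hL (invRev L₂) ⟨_, h₂.symm⟩
      refine ⟨t, ht, ?_⟩
      have h₃ : mk L₁ = (mk L)⁻¹ * mk (invRev L₂) := by
        rw [h₂, ← mul_mk, ← inv_mk, ← inv_mk]; group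
      rw [h₃, mul_assoc]
      exact H.mul_mem (H.inv_mem hx) htH
  intro h hh
  obtain ⟨L, rfl, hL⟩ := key h hh
  rw [toWord_mk]
  exact prefix_property_of_red (P := fun g => ∃ t ∈ T, g * t⁻¹ ∈ H) reduce.red hL

/-- Reading h letter by letter and inserting representatives t⁻¹ t after each prefix writes h as a
telescoping product of factors t x t'⁻¹ in H, times a last representative, which then lies in H too.
There are finitely many such elements. -/
theorem fg_of_prefixBounded [Finite X] {H : Subgroup (FreeGroup X)} {T : Set (FreeGroup X)}
    (hT : T.Finite) (hHT : PrefixBounded H T) : H.FG := by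
  set T' : Set (FreeGroup X) := insert 1 T with hT'
  set S : Set (FreeGroup X) := (T' ∪ Set.range fun p : (T' × (X × Bool)) × T' =>
    (p.1.1 : FreeGroup X) * mk [p.1.2] * (p.2 : FreeGroup X)⁻¹) ∩ H with hS
  have hT'f : T'.Finite := hT.insert 1
  have : Finite T' := hT'f
  have hSf : S.Finite := (hT'f.union (Set.finite_range _)).inter_of_left _
  refine (Subgroup.fg_iff _).mpr ⟨S, le_antisymm ?_ ?_, hSf⟩
  · exact (Subgroup.closure_le _).mpr Set.inter_subset_right
  have hle : Subgroup.closure S ≤ H := (Subgroup.closure_le _).mpr Set.inter_subset_right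
  intro h hh
  have key : ∀ L, L <+: h.toWord → ∃ t ∈ T', mk L * t⁻¹ ∈ Subgroup.closure S := by
    intro L
    induction L using List.reverseRecOn with
    | nil => exact fun _ => ⟨1, Or.inl rfl, by simp [← one_eq_mk]⟩
    | append_singleton L x ih =>
      intro hL
      obtain ⟨t₁, ht₁, h₁⟩ := ih ((List.prefix_append _ _).trans hL)
      obtain ⟨t₂, ht₂, h₂⟩ := hHT h hh _ hL
      refine ⟨t₂, Or.inr ht₂, ?_⟩
      have h₃ : t₁ * mk [x] * t₂⁻¹ = (mk L * t₁⁻¹)⁻¹ * (mk (L ++ [x]) * t₂⁻¹) := by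
        rw [← mul_mk]; group
      have h₄ : t₁ * mk [x] * t₂⁻¹ ∈ S :=
        ⟨Or.inr ⟨((⟨t₁, ht₁⟩, x), ⟨t₂, Or.inr ht₂⟩), rfl⟩, by
          rw [h₃]; exact H.mul_mem (H.inv_mem (hle h₁)) h₂⟩
      have h₅ := Subgroup.mul_mem _ h₁ (Subgroup.subset_closure h₄)
      rw [h₃] at h₅
      rwa [mul_inv_cancel_left] at h₅
  obtain ⟨t, ht, h₁⟩ := key _ List.prefix_rfl
  rw [mk_toWord] at h₁
  have htH : t ∈ H := by
    have := H.mul_mem (H.inv_mem (hle h₁)) hh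
    simpa using this
  have := Subgroup.mul_mem _ h₁ (Subgroup.subset_closure (k := S) ⟨Or.inl ht, htH⟩)
  simpa using this

/-- H t ∩ K u is empty or a single coset of H ∩ K; `z` picks a representative of it. -/
theorem PrefixBounded.inf {H K : Subgroup (FreeGroup X)} {T U : Set (FreeGroup X)}
    (hT : T.Finite) (hU : U.Finite) (hHT : PrefixBounded H T) (hKU : PrefixBounded K U) :
    ∃ V : Set (FreeGroup X), V.Finite ∧ PrefixBounded (H ⊓ K) V := by
  classical
  let z : FreeGroup X × FreeGroup X → FreeGroup X := fun p =>
    if h : ∃ g, g * p.1⁻¹ ∈ H ∧ g * p.2⁻¹ ∈ K then h.choose else 1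
  refine ⟨z '' (T ×ˢ U), (hT.prod hU).image z, fun h hh L hL => ?_⟩
  obtain ⟨t, ht, h₁⟩ := hHT h hh.1 L hL
  obtain ⟨u, hu, h₂⟩ := hKU h hh.2 L hL
  refine ⟨z (t, u), ⟨(t, u), ⟨ht, hu⟩, rfl⟩, ?_⟩
  have hex : ∃ g, g * t⁻¹ ∈ H ∧ g * u⁻¹ ∈ K := ⟨mk L, h₁, h₂⟩
  have hz : z (t, u) = hex.choose := dif_pos hex
  obtain ⟨h₃, h₄⟩ := hex.choose_spec
  rw [← hz] at h₃ h₄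
  constructor
  · simpa using H.mul_mem h₁ (H.inv_mem h₃)
  · simpa using K.mul_mem h₂ (K.inv_mem h₄)

/-- **Howson's theorem**: the intersection of two finitely generated subgroups of a free group of
finite rank is finitely generated. -/
theorem fg_inf {X : Type*} [Finite X] {H K : Subgroup (FreeGroup X)} (hH : H.FG) (hK : K.FG) :
    (H ⊓ K).FG := by
  classical
  obtain ⟨T, hT, hHT⟩ := exists_prefixBounded_of_fg hH
  obtain ⟨U, hU, hKU⟩ := exists_prefixBounded_of_fg hK
  obtain ⟨V, hV, hHKV⟩ := PrefixBounded.inf hT hU hHT hKU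
  exact fg_of_prefixBounded hV hHKV

end FreeGroup

/-! ### Finite bases of subgroups -/

theorem FreeGroupBasis.finite_of_fg {ι G : Type*} [Group G] (b : FreeGroupBasis ι G)
    [Group.FG G] : Finite ι := by
  have : Group.FG (FreeGroup ι) := Group.fg_of_surjective (f := b.repr.toMonoidHom) b.repr.surjective
  have : Group.FG (Abelianization (FreeGroup ι)) :=
    Group.fg_of_surjective (f := Abelianization.of) Quotient.mk_surjective
  have : AddGroup.FG (FreeAbelianGroup ι) := GroupFG.iff_add_fg.mp this
  have : Module.Finite ℤ (FreeAbelianGroup ι) := Module.Finite.iff_addGroup_fg.mpr this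
  exact Module.Finite.finite_basis (FreeAbelianGroup.basis ι)

theorem FreeGroup.exists_basis_of_fg {X : Type*} {H : Subgroup (FreeGroup X)} (hH : H.FG) :
    ∃ r : ℕ, Nonempty (FreeGroupBasis (Fin r) H) := by
  have : Group.FG H := (Group.fg_iff_subgroup_fg H).mpr hH
  let b := IsFreeGroup.basis H
  have : Finite (IsFreeGroup.Generators H) := b.finite_of_fg
  obtain ⟨r, ⟨e⟩⟩ := Finite.exists_equiv_fin (IsFreeGroup.Generators H)
  exact ⟨r, ⟨b.reindex e⟩⟩

theorem FreeGroupBasis.closure_range {ι G : Type*} [Group G] (b : FreeGroupBasis ι G) :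
    Subgroup.closure (Set.range b) = ⊤ := by
  have h := congrArg (Subgroup.map b.repr.symm.toMonoidHom) (FreeGroup.closure_range_of ι)
  rw [MonoidHom.map_closure, ← Set.range_comp,
    Subgroup.map_top_of_surjective _ b.repr.symm.surjective] at h
  exact h

namespace FreeTimesAbelian

variable {n : ℕ} {A : Type*} [AddCommGroup A] {H : Subgroup (FreeTimesAbelian n A)}

theorem mem_abPart {a : A} : a ∈ abPart H ↔ ((1, Multiplicative.ofAdd a) : FreeTimesAbelian n A) ∈ H :=
  Iff.rfl

/-- The homomorphism from a free group to `F_n × A` extending `u i ↦ u i t^{a i}`. -/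
def liftBasis {ι : Type*} {N : Subgroup (FreeGroup (Fin n))} (u : FreeGroupBasis ι N) (a : ι → A) :
    N →* FreeTimesAbelian n A :=
  u.lift fun i => ((u i : FreeGroup (Fin n)), Multiplicative.ofAdd (a i))

theorem liftBasis_apply {ι : Type*} {N : Subgroup (FreeGroup (Fin n))} (u : FreeGroupBasis ι N)
    (a : ι → A) (i : ι) :
    liftBasis u a (u i) = ((u i : FreeGroup (Fin n)), Multiplicative.ofAdd (a i)) := by
  simp [liftBasis]

theorem liftBasis_fst {ι : Type*} {N : Subgroup (FreeGroup (Fin n))} (u : FreeGroupBasis ι N)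
    (a : ι → A) (g : N) : (liftBasis u a g).1 = g :=
  DFunLike.congr_fun (u.ext_hom ((MonoidHom.fst _ _).comp (liftBasis u a)) N.subtype
    fun i => by simp [liftBasis_apply]) g

theorem liftBasis_mem {ι : Type*} {N : Subgroup (FreeGroup (Fin n))} (u : FreeGroupBasis ι N)
    (a : ι → A) {C : Subgroup (FreeTimesAbelian n A)}
    (hC : ∀ i, ((u i : FreeGroup (Fin n)), Multiplicative.ofAdd (a i)) ∈ C) (g : N) :
    liftBasis u a g ∈ C := by
  have : Subgroup.closure (Set.range u) ≤ C.comap (liftBasis u a) := by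
    rw [Subgroup.closure_le]
    rintro _ ⟨i, rfl⟩
    simpa [liftBasis_apply] using hC i
  rw [u.closure_range] at this
  exact this (Subgroup.mem_top g)

theorem liftBasis_eq {p : ℕ} {N : Subgroup (FreeGroup (Fin n))} (u : FreeGroupBasis (Fin p) N)
    (a : Fin p → A) (g : N) :
    liftBasis u a g =
      ((g : FreeGroup (Fin n)), Multiplicative.ofAdd (∑ k, (abelianize (u.repr g)).toAdd k • a k)) := by
  refine Prod.ext (liftBasis_fst u a g) ?_
  let φ : (Fin p → ℤ) →+ A :=
    { toFun := fun v => ∑ k, v k • a k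
      map_zero' := by simp
      map_add' := by simp [add_smul, Finset.sum_add_distrib] }
  refine DFunLike.congr_fun (u.ext_hom ((MonoidHom.snd _ _).comp (liftBasis u a))
    (φ.toMultiplicative.comp (abelianize.comp u.repr.toMonoidHom)) fun i => ?_) g
  simp [liftBasis_apply, abelianize, φ, Pi.single_apply, ite_smul]

/-- The lift of g lies in H and has free part g, so dividing by it leaves a purely abelian element.
Only membership of the u_i t^{a_i} is needed, so this applies both to H and to the subgroup
generated by a candidate basis. -/
theorem mem_iff_of_liftBasis_mem {N : Subgroup (FreeGroup (Fin n))} {ι : Type*}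
    (u : FreeGroupBasis ι N) (a : ι → A)
    (ha : ∀ i, ((u i : FreeGroup (Fin n)), Multiplicative.ofAdd (a i)) ∈ H) (g : N) (c : A) :
    ((g : FreeGroup (Fin n)), Multiplicative.ofAdd c) ∈ H ↔
      c - (liftBasis u a g).2.toAdd ∈ abPart H := by
  rw [mem_abPart, ← Subgroup.mul_mem_cancel_right H (H.inv_mem (liftBasis_mem u a ha g))]
  convert Iff.rfl using 2
  ext1
  · simp [liftBasis_fst]
  · simp [sub_eq_add_neg]

theorem SubgroupBasis.mem (β : SubgroupBasis H) (i : Fin β.p) :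
    ((β.u i : FreeGroup (Fin n)), Multiplicative.ofAdd (β.a i)) ∈ H := by
  have := Subgroup.subset_closure (k := Set.range
    (fun i => ((β.u i : FreeGroup (Fin n)), Multiplicative.ofAdd (β.a i))) ∪
      Set.range (fun j => ((1 : FreeGroup (Fin n)), Multiplicative.ofAdd (β.b j))))
    (Or.inl ⟨i, rfl⟩)
  rwa [β.closure_eq] at this

theorem SubgroupBasis.mem_iff (β : SubgroupBasis H) (g : proj H) (c : A) :
    ((g : FreeGroup (Fin n)), Multiplicative.ofAdd c) ∈ H ↔
      c - ∑ k, (abelianize (β.u.repr g)).toAdd k • β.a k ∈ abPart H := by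
  rw [mem_iff_of_liftBasis_mem β.u β.a β.mem, liftBasis_eq, toAdd_ofAdd]

theorem proj_fg (hH : H.FG) : (proj H).FG := by
  obtain ⟨S, hS, hSf⟩ := (Subgroup.fg_iff _).mp hH
  exact (Subgroup.fg_iff _).mpr ⟨_, by rw [proj, ← hS, MonoidHom.map_closure], hSf.image _⟩

theorem nonempty_subgroupBasis [AddGroup.FG A] (hH : H.FG) : Nonempty (SubgroupBasis H) := by
  obtain ⟨p, ⟨u⟩⟩ := FreeGroup.exists_basis_of_fg (proj_fg hH)
  have hu : ∀ i, ∃ a : A, ((u i : FreeGroup (Fin n)), Multiplicative.ofAdd a) ∈ H := by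
    intro i
    obtain ⟨⟨g, c⟩, hx, hxg⟩ := (u i).2
    obtain rfl : g = _ := hxg
    exact ⟨c.toAdd, hx⟩
  choose a ha using hu
  have hex : ∃ k, ∃ T : Finset A, AddSubgroup.closure (T : Set A) = abPart H ∧ T.card = k := by
    have : Module.Finite ℤ A := Module.Finite.iff_addGroup_fg.mpr inferInstance
    obtain ⟨T, hT⟩ := IsNoetherian.noetherian (AddSubgroup.toIntSubmodule (abPart H))
    refine ⟨_, T, ?_, rfl⟩
    rw [← Submodule.span_int_eq_addSubgroupClosure, hT]
    rfl
  classical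
  obtain ⟨T, hT, hTc⟩ := Nat.find_spec hex
  let b : Fin T.card → A := fun j => T.equivFin.symm j
  have hb : Set.range b = T := by
    rw [show b = Subtype.val ∘ T.equivFin.symm from rfl, Set.range_comp,
      T.equivFin.symm.surjective.range_eq, Set.image_univ]
    simp
  refine ⟨⟨p, T.card, u, a, b, ?_, by rw [hb, hT], fun T' hT' => ?_⟩⟩
  · set C := Subgroup.closure
      (Set.range (fun i => ((u i : FreeGroup (Fin n)), Multiplicative.ofAdd (a i))) ∪
        Set.range (fun j => ((1 : FreeGroup (Fin n)), Multiplicative.ofAdd (b j)))) with hC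
    have haC : ∀ i, ((u i : FreeGroup (Fin n)), Multiplicative.ofAdd (a i)) ∈ C := fun i =>
      Subgroup.subset_closure (Or.inl ⟨i, rfl⟩)
    have hbC : abPart H ≤ abPart C := by
      rw [← hT, ← hb, AddSubgroup.closure_le]
      rintro _ ⟨j, rfl⟩
      exact mem_abPart.mpr (Subgroup.subset_closure (Or.inr ⟨j, rfl⟩))
    refine le_antisymm ?_ ?_
    · rw [hC, Subgroup.closure_le, Set.union_subset_iff]
      constructor
      · rintro _ ⟨i, rfl⟩
        exact ha i
      · rintro _ ⟨j, rfl⟩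
        refine mem_abPart.mp ?_
        rw [← hT, ← hb]
        exact AddSubgroup.subset_closure ⟨j, rfl⟩
    · rintro ⟨g, c⟩ hx
      have hg : g ∈ proj H := ⟨_, hx, rfl⟩
      have h₁ := (mem_iff_of_liftBasis_mem u a ha ⟨g, hg⟩ c.toAdd).mp hx
      exact (mem_iff_of_liftBasis_mem u a haC ⟨g, hg⟩ c.toAdd).mpr (hbC h₁)
  · rw [hTc]
    exact Nat.find_min' hex ⟨T', hT', rfl⟩

end FreeTimesAbelian

/-! ### Smith normal form with divisibility -/

open Module in
/-- Smith normal form of a submodule `N` of a free module of finite rank over a principal ideal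
domain, with the divisibility of the invariant factors. -/
theorem Submodule.exists_basis_mem_iff_dvd {R : Type*} [CommRing R] [IsDomain R]
    [IsPrincipalIdealRing R] : ∀ {r : ℕ} {E : Type*} [AddCommGroup E] [Module R E]
    (_ : Basis (Fin r) R E) (N : Submodule R E), ∃ (b : Basis (Fin r) R E) (δ : Fin r → R),
      (∀ i j, i ≤ j → δ i ∣ δ j) ∧ ∀ x, x ∈ N ↔ ∀ i, δ i ∣ b.repr x i
  | 0, E, _, _, b, N => by
    refine ⟨b, fun _ => 0, fun i => i.elim0, fun x => ⟨fun _ i => i.elim0, fun _ => ?_⟩⟩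
    rw [show x = 0 from b.ext_elem fun i => i.elim0]
    exact N.zero_mem
  | r + 1, E, _, _, b, N => by
    by_cases hN : N = ⊥
    · refine ⟨b, fun _ => 0, fun _ _ _ => dvd_rfl, fun x => ?_⟩
      rw [hN, Submodule.mem_bot, ← b.repr.map_eq_zero_iff, Finsupp.ext_iff]
      simp
    -- This diagonal form carries no divisibility. With d a gcd of its entries and Bézout
    -- coefficients c, the vector y and the functional φ below satisfy φ y = 1, d y ∈ N and N ⊆ d E.
    -- So E = R y ⊕ ker φ and N = R d y ⊕ (N ∩ ker φ), and induction applies to ker φ.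
    obtain ⟨m, S⟩ := N.smithNormalForm b
    obtain ⟨d, hd⟩ := (IsPrincipalIdealRing.principal (Ideal.span (Set.range S.a))).principal
    have hdmem : d ∈ Ideal.span (Set.range S.a) := by
      rw [hd]; exact Submodule.mem_span_singleton_self d
    obtain ⟨c, hc⟩ := (Submodule.mem_span_range_iff_exists_fun R).mp hdmem
    have hda : ∀ i, ∃ e, S.a i = d * e := by
      intro i
      have : S.a i ∈ Ideal.span (Set.range S.a) := Ideal.subset_span ⟨i, rfl⟩
      rw [hd] at this
      exact Ideal.mem_span_singleton.mp this
    choose e he using hda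
    have hd0 : d ≠ 0 := by
      rintro rfl
      refine hN ((Submodule.eq_bot_iff _).mpr fun x hx => ?_)
      have h₁ := congrArg Subtype.val (S.bN.sum_repr ⟨x, hx⟩)
      simp only [Submodule.coe_sum, Submodule.coe_smul, S.snf, he, zero_mul, zero_smul,
        smul_zero, Finset.sum_const_zero] at h₁
      exact h₁.symm
    have hce : ∑ i, c i * e i = 1 := by
      refine mul_left_cancel₀ hd0 ?_
      rw [mul_one, Finset.mul_sum]
      conv_rhs => rw [← hc]
      exact Finset.sum_congr rfl fun i _ => by rw [smul_eq_mul, he]; ring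
    set y : E := ∑ i, e i • S.bM (S.f i) with hy
    set φ : E →ₗ[R] R := ∑ i, c i • S.bM.coord (S.f i) with hφ
    have hφy : φ y = 1 := by
      rw [← hce, hy, map_sum]
      refine Finset.sum_congr rfl fun j _ => ?_
      simp [hφ, Finsupp.single_apply, mul_comm]
    have hdvd : ∀ x ∈ N, ∃ z, x = d • z := by
      intro x hx
      refine ⟨∑ i, (S.bN.repr ⟨x, hx⟩ i * e i) • S.bM (S.f i), ?_⟩
      have h₁ := congrArg Subtype.val (S.bN.sum_repr ⟨x, hx⟩)
      simp only [Submodule.coe_sum, Submodule.coe_smul, S.snf] at h₁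
      refine h₁.symm.trans ?_
      rw [Finset.smul_sum]
      refine Finset.sum_congr rfl fun i _ => ?_
      rw [smul_smul, smul_smul, he]
      congr 1
      ring
    have hdy : d • y ∈ N := by
      rw [hy, Finset.smul_sum]
      refine Submodule.sum_mem _ fun i _ => ?_
      rw [smul_smul, ← he, ← S.snf]
      exact (S.bN i).2
    have hli : ∀ (c : R), ∀ x ∈ LinearMap.ker φ, c • y + x = 0 → c = 0 := by
      intro c x hx h
      have := congrArg φ h
      simpa [hφy, LinearMap.mem_ker.mp hx] using this
    have hker : ∀ z : E, z - φ z • y ∈ LinearMap.ker φ := by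
      intro z
      simp [hφy]
    have hsp : ∀ z : E, ∃ c : R, z + c • y ∈ LinearMap.ker φ := fun z =>
      ⟨-φ z, by simpa [sub_eq_add_neg] using hker z⟩
    -- Adjoining y to a basis of ker φ gives a basis of E, so the rank of ker φ is r.
    obtain ⟨bK⟩ : Nonempty (Basis (Fin r) R (LinearMap.ker φ)) := by
      obtain ⟨k, bK⟩ := Submodule.basisOfPid b (LinearMap.ker φ)
      have hk := Fintype.card_congr ((Basis.mkFinCons y bK hli hsp).indexEquiv b)
      exact ⟨bK.reindex (finCongr (by simpa using hk))⟩
    obtain ⟨b', δ', hδ', hN'⟩ := exists_basis_mem_iff_dvd bK (N.comap (LinearMap.ker φ).subtype)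
    set B := Basis.mkFinCons y b' hli hsp with hB
    have hBcoe : (B : Fin (r + 1) → E) = Fin.cons y ((↑) ∘ b') := Basis.coe_mkFinCons _ _ _ _
    have hrepr : ∀ x, (B.repr x : Fin (r + 1) → R) =
        Fin.cons (φ x) (b'.repr ⟨x - φ x • y, hker x⟩) := by
      intro x
      set v : Fin (r + 1) → R := Fin.cons (φ x) (b'.repr ⟨x - φ x • y, hker x⟩) with hv
      have hx : ∑ i, v i • B i = x := by
        have h₁ := congrArg Subtype.val (b'.sum_repr ⟨x - φ x • y, hker x⟩)
        simp only [Submodule.coe_sum, Submodule.coe_smul] at h₁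
        rw [Fin.sum_univ_succ, hBcoe, hv]
        simp [h₁]
      conv_lhs => rw [← hx]
      exact B.repr_sum_self v
    refine ⟨B, Fin.cons d δ', ?_, ?_⟩
    -- δ'_i b'_i lies in N ⊆ d E, and its coordinate at b'_i is δ'_i.
    · have hdδ : ∀ i, d ∣ δ' i := by
        intro i
        have h₁ : δ' i • b' i ∈ N.comap (LinearMap.ker φ).subtype := by
          rw [hN']
          intro j
          by_cases hij : i = j
          · subst hij; simp
          · simp [hij]
        obtain ⟨z, hz⟩ := hdvd _ h₁
        have h₂ := congrArg (fun x => B.repr x i.succ) hz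
        have h₃ : ((b' i : LinearMap.ker φ) : E) = B i.succ := by simp [hBcoe]
        simp [h₃] at h₂
        exact ⟨_, h₂⟩
      intro i j
      refine Fin.cases ?_ (fun i => ?_) i <;> refine Fin.cases ?_ (fun j => ?_) j
      · simp
      · simpa using hdδ j
      · simp
      · simpa using hδ' i j
    · intro x
      rw [Fin.forall_fin_succ, hrepr]
      simp only [Fin.cons_zero, Fin.cons_succ]
      rw [← hN' ⟨x - φ x • y, hker x⟩]
      simp only [Submodule.mem_comap, Submodule.subtype_apply]
      have hmul : d ∣ φ x → φ x • y ∈ N := by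
        rintro ⟨q, hq⟩
        rw [hq, mul_comm, mul_smul]
        exact N.smul_mem q hdy
      constructor
      · intro hx
        have hdx : d ∣ φ x := by
          obtain ⟨z, hz⟩ := hdvd x hx
          exact ⟨φ z, by rw [hz]; simp⟩
        exact ⟨hdx, N.sub_mem hx (hmul hdx)⟩
      · rintro ⟨h₁, h₂⟩
        simpa using N.add_mem h₂ (hmul h₁)

namespace SmithDecomposition

variable {r : ℕ}

/-- In an adapted basis b of ℤ^r, the δ_i b_i with δ_i ≠ 0 form a basis of M. Take them as rows, P =
1, and Q the change from standard coordinates to b-coordinates. -/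
theorem nonempty (M : AddSubgroup (Fin r → ℤ)) : Nonempty (SmithDecomposition M) := by
  classical
  obtain ⟨b, δ, hδ, hM⟩ := Submodule.exists_basis_mem_iff_dvd (Pi.basisFun ℤ (Fin r))
    (AddSubgroup.toIntSubmodule M)
  replace hM : ∀ x, x ∈ M ↔ ∀ i, δ i ∣ b.repr x i := hM
  have hex : ∃ k : ℕ, ∀ i : Fin r, k ≤ i → δ i = 0 := ⟨r, fun i hi => absurd i.2 (by omega)⟩
  -- Zero divides only zero, so the vanishing δ_i come last and s counts the nonzero ones.
  set s := Nat.find hex with hs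
  have hsr : s ≤ r := Nat.find_min' hex fun i hi => absurd i.2 (by omega)
  have hne : ∀ i : Fin r, δ i ≠ 0 ↔ (i : ℕ) < s := by
    intro i
    constructor
    · intro h
      by_contra h'
      exact h (Nat.find_spec hex i (not_lt.mp h'))
    · intro h h0
      refine Nat.find_min hex h fun j hj => ?_
      have := hδ i j hj
      rwa [h0, zero_dvd_iff] at this
  have hrepr : ∀ (x : Fin r → ℤ) j, ∑ k, x k * b.repr (Pi.single k 1) j = b.repr x j := by
    intro x j
    conv_rhs => rw [← (Pi.basisFun ℤ (Fin r)).sum_repr x, map_sum]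
    simp only [map_smul, Finsupp.coe_finsetSum, Finset.sum_apply, Finsupp.smul_apply,
      Pi.basisFun_repr, Pi.basisFun_apply, smul_eq_mul]
  let Q : GL (Fin r) ℤ :=
    { val := Matrix.of fun k j => b.repr (Pi.single k 1) j
      inv := Matrix.of fun i k => b i k
      val_inv := by
        ext i j
        have := congrFun (b.sum_repr (Pi.single i 1)) j
        simpa [Matrix.mul_apply, Matrix.one_apply, Pi.single_apply, eq_comm] using this
      inv_val := by
        ext i j
        simp [Matrix.mul_apply, hrepr, Matrix.one_apply, Finsupp.single_apply] }
  have hrow : ∀ i : Fin s, (Matrix.of fun (i : Fin s) (j : Fin r) =>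
      δ (Fin.castLE hsr i) * b (Fin.castLE hsr i) j).row i =
        δ (Fin.castLE hsr i) • b (Fin.castLE hsr i) := fun i => rfl
  refine ⟨⟨s, Matrix.of fun i j => δ (Fin.castLE hsr i) * b (Fin.castLE hsr i) j, ?_, ?_, 1, Q, δ,
    ?_, hne, hδ⟩⟩
  · have hli := b.linearIndependent.comp (Fin.castLE hsr) (Fin.castLE_injective hsr)
    rw [Fintype.linearIndependent_iff] at hli ⊢
    intro g hg i
    have h₁ := hli (fun i => g i * δ (Fin.castLE hsr i)) (by
      simpa [hrow, mul_smul] using hg) i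
    exact (mul_eq_zero.mp h₁).resolve_right ((hne _).mpr i.2)
  · refine le_antisymm ((AddSubgroup.closure_le _).mpr ?_) fun x hx => ?_
    · rintro _ ⟨i, rfl⟩
      rw [hrow]
      refine (hM _).mpr fun j => ?_
      rw [map_smul, Finsupp.smul_apply, b.repr_self, Finsupp.single_apply, smul_eq_mul]
      split_ifs with hij
      · rw [hij, mul_one]
      · simp
    · rw [← b.sum_repr x]
      refine sum_mem fun j _ => ?_
      obtain ⟨q, hq⟩ := (hM x).mp hx j
      by_cases hj : δ j = 0
      · rw [hq, hj]; simp
      · have h₁ : δ j • b j ∈ AddSubgroup.closure (Set.range (Matrix.of fun (i : Fin s) j =>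
            δ (Fin.castLE hsr i) * b (Fin.castLE hsr i) j).row) :=
          AddSubgroup.subset_closure ⟨⟨j, (hne j).mp hj⟩, rfl⟩
        rw [hq, mul_comm, mul_smul]
        exact zsmul_mem h₁ q
  · ext i j
    rw [Units.val_one, Matrix.one_mul, Matrix.mul_apply, Matrix.of_apply]
    simp only [Matrix.of_apply, Q, mul_assoc, ← Finset.mul_sum, hrepr]
    rw [b.repr_self, Finsupp.single_apply]
    by_cases hij : (i : ℕ) = j
    · obtain rfl : Fin.castLE hsr i = j := Fin.ext hij
      simp
    · have : Fin.castLE hsr i ≠ j := fun h => hij (by rw [← h]; rfl)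
      simp [hij, this]

variable {M : AddSubgroup (Fin r → ℤ)} (σ : SmithDecomposition M)

open Matrix

theorem mem_iff_vecMul (v : Fin r → ℤ) :
    v ∈ M ↔ ∃ c : Fin σ.s → ℤ, c ᵥ* σ.B = v := by
  have : v ∈ M ↔ v ∈ Submodule.span ℤ (Set.range σ.B.row) := by
    rw [← Submodule.mem_toAddSubgroup, Submodule.span_int_eq_addSubgroupClosure, σ.closure_rows]
  rw [this, Submodule.mem_span_range_iff_exists_fun]
  simp only [Matrix.vecMul_eq_sum]
  rfl

/-- Since P is invertible, c B Q runs over the row space of S as c varies; this consists of the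
vectors whose j-th coordinate is a multiple of δ_j, hence zero beyond s. -/
theorem mem_iff_dvd (v : Fin r → ℤ) :
    v ∈ M ↔ ∀ j, σ.δ j ∣ (v ᵥ* (σ.Q : Matrix (Fin r) (Fin r) ℤ)) j := by
  set S : Matrix (Fin σ.s) (Fin r) ℤ :=
    Matrix.of fun i j => if (i : ℕ) = (j : ℕ) then σ.δ j else 0 with hS
  have hσ : (σ.P : Matrix (Fin σ.s) (Fin σ.s) ℤ) * σ.B * (σ.Q : Matrix (Fin r) (Fin r) ℤ) = S :=
    σ.eq_smith
  rw [σ.mem_iff_vecMul]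
  constructor
  · rintro ⟨c, rfl⟩ j
    have h₁ : σ.B * (σ.Q : Matrix (Fin r) (Fin r) ℤ) =
        ((σ.P⁻¹ : GL (Fin σ.s) ℤ) : Matrix (Fin σ.s) (Fin σ.s) ℤ) * S := by
      rw [← hσ, Matrix.mul_assoc, ← Matrix.mul_assoc, Units.inv_mul, Matrix.one_mul]
    rw [Matrix.vecMul_vecMul, h₁, ← Matrix.vecMul_vecMul]
    rw [Matrix.vecMul, dotProduct]
    refine Finset.dvd_sum fun i _ => ?_
    rw [hS, Matrix.of_apply]
    split_ifs <;> simp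
  · intro h
    choose q hq using h
    -- The structure does not record s ≤ r. A row of S with index at least r would be zero, so the
    -- default value is harmless.
    let d : Fin σ.s → ℤ := fun i => if h : (i : ℕ) < r then q ⟨i, h⟩ else 0
    have hd : d ᵥ* S = v ᵥ* (σ.Q : Matrix (Fin r) (Fin r) ℤ) := by
      ext j
      rw [hq]
      by_cases hj : (j : ℕ) < σ.s
      · rw [Matrix.vecMul, dotProduct, Finset.sum_eq_single ⟨j, hj⟩]
        · simp [d, hS, mul_comm]
        · intro i _ hi
          have : (i : ℕ) ≠ j := fun h => hi (Fin.ext h)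
          simp [hS, this]
        · simp
      · have h0 : σ.δ j = 0 := by
          by_contra h0
          exact hj ((σ.ne_zero_iff j).mp h0)
        rw [h0, zero_mul, Matrix.vecMul, dotProduct]
        refine Finset.sum_eq_zero fun i _ => ?_
        simp [hS, h0]
    refine ⟨d ᵥ* (σ.P : Matrix (Fin σ.s) (Fin σ.s) ℤ), ?_⟩
    have h₁ := congrArg (fun x => x ᵥ* ((σ.Q⁻¹ : GL (Fin r) ℤ) : Matrix (Fin r) (Fin r) ℤ)) hd
    simp only [← hσ, Matrix.vecMul_vecMul, Units.mul_inv, Matrix.vecMul_one] at h₁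
    rw [Matrix.mul_assoc, Units.mul_inv, Matrix.mul_one] at h₁
    rw [Matrix.vecMul_vecMul, h₁]

/-- The homomorphism `v ↦ v Q` from `ℤ^r` to the direct sum of the groups `ℤ/δ_i ℤ`. -/
def toCyclicSum : (Fin r → ℤ) →+ σ.cyclicSum where
  toFun v i := QuotientAddGroup.mk ((v ᵥ* (σ.Q : Matrix (Fin r) (Fin r) ℤ)) i)
  map_zero' := by
    ext i
    simp
  map_add' v v' := by
    ext i
    simp [Matrix.add_vecMul]

theorem toCyclicSum_single (j : Fin r) : σ.toCyclicSum (Pi.single j 1) = σ.rowQ j := by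
  ext i
  simp [toCyclicSum, rowQ, Matrix.row]

theorem toCyclicSum_eq_zero_iff (v : Fin r → ℤ) : σ.toCyclicSum v = 0 ↔ v ∈ M := by
  rw [σ.mem_iff_dvd, funext_iff]
  refine forall_congr' fun j => ?_
  exact (QuotientAddGroup.eq_zero_iff _).trans Int.mem_zmultiples_iff

theorem toCyclicSum_surjective : Function.Surjective σ.toCyclicSum := by
  intro x
  choose y hy using fun i => QuotientAddGroup.mk_surjective (x i)
  refine ⟨y ᵥ* ((σ.Q⁻¹ : GL (Fin r) ℤ) : Matrix (Fin r) (Fin r) ℤ), ?_⟩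
  ext i
  rw [← hy]
  simp only [toCyclicSum, AddMonoidHom.coe_mk, ZeroHom.coe_mk, Matrix.vecMul_vecMul,
    Units.inv_mul, Matrix.vecMul_one]

theorem closure_rowQ : AddSubgroup.closure (Set.range σ.rowQ) = ⊤ := by
  refine (AddSubgroup.eq_top_iff' _).mpr fun x => ?_
  obtain ⟨v, rfl⟩ := σ.toCyclicSum_surjective x
  rw [← Finset.univ_sum_single v, map_sum]
  refine sum_mem fun j _ => ?_
  have h₁ : (Pi.single j (v j) : Fin r → ℤ) = v j • Pi.single j 1 := by
    rw [← Pi.single_smul]; simp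
  rw [h₁, map_zsmul, toCyclicSum_single]
  exact zsmul_mem (AddSubgroup.subset_closure (Set.mem_range_self j)) _

end SmithDecomposition

/-! ### Reduced words in normal subgroups -/

namespace FreeGroup

variable {X : Type*}

theorem head?_invRev (L : List (X × Bool)) :
    (FreeGroup.invRev L).head? = L.getLast?.map fun e => (e.1, !e.2) := by
  simp [FreeGroup.invRev]

variable [DecidableEq X]

/-- Each letter of L₂ cancels at most one letter of L₁, so a shorter L₂ never reaches the first
letter of L₁. -/
theorem head?_reduce_append : ∀ {L₁ L₂ : List (X × Bool)}, IsReduced L₁ →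
    L₂.length < L₁.length → (reduce (L₁ ++ L₂)).head? = L₁.head?
  | L₁, [], h, _ => by rw [List.append_nil, h.reduce_eq]
  | L₁, x :: L₂, h, hlen => by
    by_cases hx : IsReduced (L₁ ++ [x])
    · rw [List.append_cons, head?_reduce_append hx (by simp at hlen ⊢; omega)]
      cases L₁ <;> simp at hlen ⊢
    · obtain ⟨L, y, rfl⟩ : ∃ L y, L₁ = L ++ [y] := by
        rcases List.eq_nil_or_concat L₁ with rfl | ⟨L, y, h⟩
        · simp at hlen
        · exact ⟨L, y, by simpa using h⟩
      have hxy : x = (y.1, !y.2) := by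
        rw [IsReduced, List.isChain_append] at hx
        simp only [show (L ++ [y]).IsChain _ from h, List.isChain_singleton, true_and] at hx
        simp at hx
        ext
        · exact hx.1.symm
        · have := hx.2
          revert this
          cases x.2 <;> cases y.2 <;> simp
      have hred : reduce (L ++ [y] ++ x :: L₂) = reduce (L ++ L₂) := by
        refine reduce.Step.eq ?_
        rw [hxy, List.append_assoc]
        exact Red.Step.not
      rw [hred, head?_reduce_append (h.infix (List.prefix_append _ _).isInfix)
        (by simp at hlen; omega)]
      cases L <;> simp at hlen ⊢

theorem IsReduced.invRev {L : List (X × Bool)} (h : IsReduced L) : IsReduced (invRev L) := by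
  rw [isReduced_iff_reduce_eq, reduce_invRev, h.reduce_eq]

/-- In a nontrivial normal subgroup of a free group, every reduced word is a prefix of the reduced
word of some element. -/
theorem exists_isReduced_append {K : Subgroup (FreeGroup X)} [K.Normal] (hK : K ≠ ⊥)
    (u : FreeGroup X) : ∃ Z, IsReduced (u.toWord ++ Z) ∧ u * mk Z ∈ K := by
  -- The cyclically reduced core C of c is a conjugate of c, hence in K, and its powers are reduced
  -- and arbitrarily long. Z will be the reduced form of E u⁻¹, with E a power of C or its inverse,
  -- so that u Z = u E u⁻¹ ∈ K.
  obtain ⟨c, hcK, hc⟩ := K.bot_or_exists_ne_one.resolve_left hK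
  set C := reduceCyclically c.toWord with hCdef
  have hC : IsCyclicallyReduced C := reduceCyclically.isCyclicallyReduced isReduced_toWord
  have hconj := reduceCyclically.conj_conjugator_reduceCyclically c.toWord
  set V := reduceCyclically.conjugator c.toWord with hV
  have hCK : mk C ∈ K := by
    have h₁ : mk V * mk C * (mk V)⁻¹ = c := by
      rw [inv_mk, mul_mk, mul_mk, hconj, mk_toWord]
    have h₂ := ‹K.Normal›.conj_mem _ hcK (mk V)⁻¹
    have h₃ : mk C = (mk V)⁻¹ * c * (mk V)⁻¹⁻¹ := by
      rw [← h₁]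
      generalize mk V = v
      group
    rwa [h₃]
  have hC0 : C ≠ [] := by
    intro h0
    rw [← hCdef, h0] at hconj
    refine hc (toWord_eq_nil_iff.mp ?_)
    rw [← reduce_toWord, ← hconj, List.append_nil]
    have := reduce_invRev_left_cancel (L := invRev V)
    rwa [invRev_invRev] at this
  set N := u.toWord.length + 1 with hN
  set D := (List.replicate N C).flatten with hD
  have hDr : IsReduced D := (hC.flatten_replicate N).isReduced
  have hDK : mk D ∈ K := by
    have : mk D = mk C ^ N := by rw [pow_mk]
    rw [this]
    exact K.pow_mem hCK N
  have hDlen : u.toWord.length < D.length := by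
    have h₁ : 0 < C.length := List.length_pos_iff.mpr hC0
    have h₂ : D.length = N * C.length := by simp [hD]
    rw [h₂, hN]
    nlinarith
  -- If both D and D⁻¹ cancelled against the last letter of u, the first and last letters of D would
  -- be mutually inverse, contradicting cyclic reducedness.
  have key : ∃ E : List (X × Bool), IsReduced E ∧ mk E ∈ K ∧ u.toWord.length < E.length ∧
      ∀ x ∈ u.toWord.getLast?, ∀ y ∈ E.head?, x.1 = y.1 → x.2 = y.2 := by
    by_cases h : ∀ x ∈ u.toWord.getLast?, ∀ y ∈ D.head?, x.1 = y.1 → x.2 = y.2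
    · exact ⟨D, hDr, hDK, hDlen, h⟩
    · refine ⟨invRev D, hDr.invRev, ?_, by simpa using hDlen, ?_⟩
      · rw [← inv_mk]
        exact K.inv_mem hDK
      · push Not at h
        obtain ⟨x, hx, y, hy, hxy, hxy'⟩ := h
        intro x' hx' z hz hxz
        obtain rfl : x = x' := Option.mem_unique hx hx'
        rw [head?_invRev] at hz
        obtain ⟨e, he, rfl⟩ := Option.mem_map.mp hz
        have h₁ := (hC.flatten_replicate N).2 e he y hy
        simp only at hxz ⊢
        have h₂ := h₁ (hxz.symm.trans hxy)
        rw [h₂]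
        revert hxy'
        cases x.2 <;> cases y.2 <;> simp
  obtain ⟨E, hE, hEK, hlen, hcomp⟩ := key
  refine ⟨reduce (E ++ invRev u.toWord), ?_, ?_⟩
  · rw [IsReduced, List.isChain_append]
    refine ⟨isReduced_toWord, ?_, ?_⟩
    · rw [← toWord_mk]
      exact isReduced_toWord
    -- E is longer than u, so Z begins with the first letter of E, which does not cancel with u.
    · rw [head?_reduce_append hE (by simpa using hlen)]
      exact hcomp
  · rw [reduce.self, ← mul_mk, ← inv_mk, mk_toWord, ← mul_assoc]
    exact ‹K.Normal›.conj_mem _ hEK u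

end FreeGroup

/-! ### Schreier automata of normal subgroups -/

namespace XAutomaton

variable {X : Type*}

/-- Composition of isomorphisms of automata. -/
def Iso.trans {Γ Δ Θ : XAutomaton X} (f : Iso Γ Δ) (g : Iso Δ Θ) : Iso Γ Θ where
  onVertex := f.onVertex.trans g.onVertex
  onArc := f.onArc.trans g.onArc
  map_source _ := (g.map_source _).trans (congrArg g.onVertex (f.map_source _))
  map_target _ := (g.map_target _).trans (congrArg g.onVertex (f.map_target _))
  map_label _ := (g.map_label _).trans (f.map_label _)
  map_base := (congrArg g.onVertex f.map_base).trans g.map_base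

/-- An automaton all of whose vertices are core vertices is its own core. -/
def coreIso {Γ : XAutomaton X} (h : ∀ p, Γ.IsCoreVertex p) : Iso Γ.core Γ where
  onVertex := Equiv.subtypeUnivEquiv h
  onArc := Equiv.subtypeUnivEquiv fun _ => ⟨h _, h _⟩
  map_source _ := rfl
  map_target _ := rfl
  map_label _ := rfl
  map_base := rfl

end XAutomaton

section Schreier

variable {ι F : Type*} [Group F]

theorem rightCosetMul_mk (H : Subgroup F) (g u : F) :
    rightCosetMul H g (Quotient.mk _ u) = Quotient.mk _ (u * g) := rfl

theorem rightCosetMul_one (H : Subgroup F) (p : Quotient (QuotientGroup.rightRel H)) :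
    rightCosetMul H 1 p = p := by
  induction p using Quotient.inductionOn with
  | h u => rw [rightCosetMul_mk, mul_one]

theorem rightCosetMul_mul (H : Subgroup F) (g h : F) (p : Quotient (QuotientGroup.rightRel H)) :
    rightCosetMul H (g * h) p = rightCosetMul H h (rightCosetMul H g p) := by
  induction p using Quotient.inductionOn with
  | h u => rw [rightCosetMul_mk, rightCosetMul_mk, rightCosetMul_mk, mul_assoc]

variable (W : FreeGroupBasis ι F) (H : Subgroup F)

/-- The walk in the Schreier automaton that starts at `p` and reads a given word. -/
def schreierWalk : Quotient (QuotientGroup.rightRel H) → List (ι × Bool) →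
    List ((schreierAutomaton W H).Arc × Bool)
  | _, [] => []
  | p, (i, true) :: L => ((p, i), true) :: schreierWalk (rightCosetMul H (W i) p) L
  | p, (i, false) :: L =>
    ((rightCosetMul H (W i)⁻¹ p, i), false) :: schreierWalk (rightCosetMul H (W i)⁻¹ p) L

theorem isWalk_schreierWalk : ∀ (L : List (ι × Bool)) (p q : Quotient (QuotientGroup.rightRel H)),
    rightCosetMul H (W.repr.symm (FreeGroup.mk L)) p = q →
      (schreierAutomaton W H).IsWalk p (schreierWalk W H p L) q
  | [], p, q, h => by
    rw [← FreeGroup.one_eq_mk, map_one, rightCosetMul_one] at h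
    exact h
  | (i, true) :: L, p, q, h => by
    have h₁ : FreeGroup.mk ((i, true) :: L) = FreeGroup.of i * FreeGroup.mk L := rfl
    rw [h₁, map_mul, rightCosetMul_mul] at h
    exact ⟨rfl, isWalk_schreierWalk L _ q h⟩
  | (i, false) :: L, p, q, h => by
    have h₁ : FreeGroup.mk ((i, false) :: L) = (FreeGroup.of i)⁻¹ * FreeGroup.mk L := rfl
    rw [h₁, map_mul, rightCosetMul_mul, map_inv] at h
    refine ⟨?_, isWalk_schreierWalk L _ q h⟩
    change rightCosetMul H (W i) (rightCosetMul H (W i)⁻¹ p) = p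
    rw [← rightCosetMul_mul, inv_mul_cancel, rightCosetMul_one]

theorem map_schreierWalk : ∀ (p : Quotient (QuotientGroup.rightRel H)) (L : List (ι × Bool)),
    (schreierWalk W H p L).map (fun e => ((schreierAutomaton W H).label e.1, e.2)) = L
  | _, [] => rfl
  | _, (i, true) :: L => congrArg ((i, true) :: ·) (map_schreierWalk _ L)
  | _, (i, false) :: L => congrArg ((i, false) :: ·) (map_schreierWalk _ L)

/-- Extend the reduced word of u to a reduced word u Z in H; reading it from the basepoint gives a
closed walk through Hu. -/
theorem isCoreVertex_schreierAutomaton [H.Normal] (hH : H ≠ ⊥)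
    (p : (schreierAutomaton W H).Vertex) : (schreierAutomaton W H).IsCoreVertex p := by
  classical
  obtain ⟨u, rfl⟩ : ∃ u, Quotient.mk (QuotientGroup.rightRel H) u = p := Quotient.exists_rep p
  have hK : H.comap W.repr.symm.toMonoidHom ≠ ⊥ := by
    obtain ⟨c, hcH, hc⟩ := H.bot_or_exists_ne_one.resolve_left hH
    intro h
    have h₁ : W.repr c ∈ H.comap W.repr.symm.toMonoidHom := by simpa using hcH
    rw [h, Subgroup.mem_bot] at h₁
    exact hc (by simpa using h₁)
  obtain ⟨Z, hZ, hZH⟩ := FreeGroup.exists_isReduced_append hK (W.repr u)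
  refine ⟨schreierWalk W H (Quotient.mk _ 1) (W.repr u).toWord,
    schreierWalk W H (Quotient.mk _ u) Z, isWalk_schreierWalk W H _ _ _ ?_,
    isWalk_schreierWalk W H _ _ _ ?_, ?_⟩
  · rw [FreeGroup.mk_toWord, MulEquiv.symm_apply_apply]
    exact (rightCosetMul_mk H u 1).trans (by rw [one_mul])
  · rw [rightCosetMul_mk]
    refine Quotient.sound (QuotientGroup.rightRel_apply.mpr ?_)
    simpa using H.inv_mem hZH
  -- Backtracking in the walk would give consecutive inverse letters in its label, which is reduced.
  · have h₁ : ((schreierWalk W H (Quotient.mk _ 1) (W.repr u).toWord ++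
        schreierWalk W H (Quotient.mk _ u) Z).map
          fun e => ((schreierAutomaton W H).label e.1, e.2)).IsChain
            fun a b => a.1 = b.1 → a.2 = b.2 := by
      rw [List.map_append, map_schreierWalk, map_schreierWalk]
      exact hZ
    rw [List.isChain_map] at h₁
    refine h₁.imp fun a b hab hba => ?_
    subst hba
    simpa using hab rfl

/-- For a surjective homomorphism `θ` with kernel `H`, the Schreier automaton of `H` is the Cayley
multidigraph of the image with respect to the images of the basis. -/
noncomputable def schreierIsoCayley {C : Type*} [Group C] (θ : F →* C)
    (hθ : Function.Surjective θ) (hker : θ.ker = H) (h : ι → C) (hh : ∀ i, θ (W i) = h i) :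
    XAutomaton.Iso (schreierAutomaton W H) (cayleyMultidigraph h) :=
  have hrel : ∀ u v : F, (QuotientGroup.rightRel H) u v ↔ θ u = θ v := fun u v => by
    rw [QuotientGroup.rightRel_apply, ← hker, MonoidHom.mem_ker, map_mul, map_inv,
      mul_inv_eq_one, eq_comm]
  let f : Quotient (QuotientGroup.rightRel H) → C := Quotient.lift θ fun u v huv => (hrel u v).mp huv
  have hf : Function.Bijective f := by
    constructor
    · intro p q
      induction p, q using Quotient.inductionOn₂ with
      | h u v => exact fun huv => Quotient.sound ((hrel u v).mpr huv)
    · intro c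
      obtain ⟨u, rfl⟩ := hθ c
      exact ⟨Quotient.mk _ u, rfl⟩
  { onVertex := Equiv.ofBijective f hf
    onArc := Equiv.prodCongr (Equiv.ofBijective f hf) (Equiv.refl ι)
    map_source := fun _ => rfl
    map_target := by
      rintro ⟨p, i⟩
      induction p using Quotient.inductionOn with
      | h u =>
        change θ u * h i = θ (u * W i)
        rw [map_mul, hh]
    map_label := fun _ => rfl
    map_base := map_one θ }

end Schreier

/-! ### The intersection as the preimage of a lattice -/

namespace FreeTimesAbelian

variable {n : ℕ} {A : Type*} [AddCommGroup A] {H₁ H₂ : Subgroup (FreeTimesAbelian n A)} {r : ℕ}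

/-- The abelianization of a subgroup of a free group with respect to a finite basis. -/
def abelianizeBasis {N : Type*} [Group N] {p : ℕ} (u : FreeGroupBasis (Fin p) N) :
    N →* Multiplicative (Fin p → ℤ) :=
  abelianize.comp u.repr.toMonoidHom

theorem abelianizeBasis_apply {N : Type*} [Group N] {p : ℕ} (u : FreeGroupBasis (Fin p) N)
    (i : Fin p) : abelianizeBasis u (u i) = Multiplicative.ofAdd (Pi.single i 1) := by
  simp [abelianizeBasis, abelianize]

theorem abelianizeBasis_surjective {N : Type*} [Group N] {p : ℕ} (u : FreeGroupBasis (Fin p) N) :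
    Function.Surjective (abelianizeBasis u) := by
  intro v
  refine ⟨(List.ofFn fun i => u i ^ (v.toAdd i)).prod, ?_⟩
  rw [map_list_prod, List.map_ofFn, List.prod_ofFn]
  simp only [Function.comp_def, map_zpow, abelianizeBasis_apply, ← ofAdd_zsmul, ← ofAdd_sum]
  refine Multiplicative.toAdd.injective (funext fun j => ?_)
  simp [Finset.sum_apply, Pi.single_apply]

/-- Both sides are homomorphisms in g that agree on the basis w, where the right side picks out a
row of the matrix. -/
theorem abelianize_inclusion {K N : Subgroup (FreeGroup (Fin n))} {p : ℕ} (h : K ≤ N)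
    (w : FreeGroupBasis (Fin r) K) (u : FreeGroupBasis (Fin p) N) (g : K) (k : Fin p) :
    (abelianize (u.repr (Subgroup.inclusion h g))).toAdd k =
      ∑ j, (abelianizeBasis w g).toAdd j * inclusionMatrix h w u j k := by
  let φ : (Fin r → ℤ) →+ (Fin p → ℤ) :=
    { toFun := fun v => Matrix.vecMul v (inclusionMatrix h w u)
      map_zero' := Matrix.zero_vecMul _
      map_add' := fun _ _ => Matrix.add_vecMul _ _ _ }
  have h₁ : (abelianizeBasis u).comp (Subgroup.inclusion h) =
      φ.toMultiplicative.comp (abelianizeBasis w) := by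
    refine w.ext_hom _ _ fun j => ?_
    rw [MonoidHom.comp_apply, MonoidHom.comp_apply, abelianizeBasis_apply]
    refine Multiplicative.toAdd.injective ?_
    exact (Matrix.single_one_vecMul j (inclusionMatrix h w u)).symm
  exact congrFun (congrArg Multiplicative.toAdd (DFunLike.congr_fun h₁ g)) k

theorem sum_abelianize_inclusion {K N : Subgroup (FreeGroup (Fin n))} {p : ℕ} (h : K ≤ N)
    (w : FreeGroupBasis (Fin r) K) (u : FreeGroupBasis (Fin p) N) (a : Fin p → A) (g : K) :
    ∑ k, (abelianize (u.repr (Subgroup.inclusion h g))).toAdd k • a k =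
      ∑ j, (abelianizeBasis w g).toAdd j • ∑ k, inclusionMatrix h w u j k • a k := by
  simp only [abelianize_inclusion h w u, Finset.sum_smul, Finset.smul_sum, mul_smul]
  exact Finset.sum_comm

/-- The abelian parts completing g to an element of H_i form the coset c_i + L_i; the two cosets
meet exactly when c₁ - c₂ ∈ L₁ + L₂. -/
theorem mem_proj_inf_iff (β₁ : SubgroupBasis H₁) (β₂ : SubgroupBasis H₂)
    (w : FreeGroupBasis (Fin r) ↥(proj H₁ ⊓ proj H₂)) (g : ↥(proj H₁ ⊓ proj H₂)) :
    (g : FreeGroup (Fin n)) ∈ proj (H₁ ⊓ H₂) ↔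
      (abelianizeBasis w g).toAdd ∈ preimageLattice β₁ β₂ w := by
  set c₁ : A := ∑ k, (abelianize (β₁.u.repr (Subgroup.inclusion inf_le_left g))).toAdd k • β₁.a k
    with hc₁
  set c₂ : A := ∑ k, (abelianize (β₂.u.repr (Subgroup.inclusion inf_le_right g))).toAdd k • β₂.a k
    with hc₂
  have h₁ : ∀ c : A, ((g : FreeGroup (Fin n)), Multiplicative.ofAdd c) ∈ H₁ ↔
      c - c₁ ∈ abPart H₁ := β₁.mem_iff (Subgroup.inclusion inf_le_left g)
  have h₂ : ∀ c : A, ((g : FreeGroup (Fin n)), Multiplicative.ofAdd c) ∈ H₂ ↔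
      c - c₂ ∈ abPart H₂ := β₂.mem_iff (Subgroup.inclusion inf_le_right g)
  have h₃ : diffHom β₁ β₂ w (abelianizeBasis w g).toAdd = c₁ - c₂ := by
    rw [hc₁, hc₂, sum_abelianize_inclusion inf_le_left w, sum_abelianize_inclusion inf_le_right w,
      ← Finset.sum_sub_distrib]
    simp only [← smul_sub]
    rfl
  rw [preimageLattice, AddSubgroup.mem_comap, h₃, AddSubgroup.mem_sup]
  constructor
  · rintro ⟨⟨_, c⟩, ⟨hx₁, hx₂⟩, rfl⟩
    refine ⟨-(c.toAdd - c₁), neg_mem ((h₁ _).mp hx₁), c.toAdd - c₂, (h₂ _).mp hx₂, by abel⟩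
  · rintro ⟨x, hx, y, hy, hxy⟩
    -- From c₁ - c₂ = x + y, the element c₁ - x = c₂ + y lies in both cosets.
    refine ⟨((g : FreeGroup (Fin n)), Multiplicative.ofAdd (c₁ - x)),
      ⟨(h₁ _).mpr ?_, (h₂ _).mpr ?_⟩, rfl⟩
    · rw [show c₁ - x - c₁ = -x by abel]
      exact neg_mem hx
    · rw [show c₁ - x - c₂ = c₁ - c₂ - x by abel, ← hxy, add_sub_cancel_left]
      exact hy

theorem proj_inf_le : proj (H₁ ⊓ H₂) ≤ proj H₁ ⊓ proj H₂ :=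
  le_inf (Subgroup.map_mono inf_le_left) (Subgroup.map_mono inf_le_right)

end FreeTimesAbelian

/-! ### The main theorem -/

theorem mainTheorem2 {n : ℕ} {A : Type*} [AddCommGroup A] [AddGroup.FG A]
    (H₁ H₂ : Subgroup (FreeTimesAbelian n A)) (hH₁ : H₁.FG) (hH₂ : H₂.FG)
    (hne : FreeTimesAbelian.proj (H₁ ⊓ H₂) ≠ ⊥) :
    Nonempty (FreeTimesAbelian.SubgroupBasis H₁) ∧
    Nonempty (FreeTimesAbelian.SubgroupBasis H₂) ∧
    (∃ r : ℕ, Nonempty (FreeGroupBasis (Fin r)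
      ↥(FreeTimesAbelian.proj H₁ ⊓ FreeTimesAbelian.proj H₂))) ∧
    ∀ (β₁ : FreeTimesAbelian.SubgroupBasis H₁) (β₂ : FreeTimesAbelian.SubgroupBasis H₂) (r : ℕ)
      (w : FreeGroupBasis (Fin r) ↥(FreeTimesAbelian.proj H₁ ⊓ FreeTimesAbelian.proj H₂)),
      Nonempty (SmithDecomposition (FreeTimesAbelian.preimageLattice β₁ β₂ w)) ∧
      ∀ σ : SmithDecomposition (FreeTimesAbelian.preimageLattice β₁ β₂ w),
        AddSubgroup.closure (Set.range σ.rowQ) = ⊤ ∧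
        Nonempty (XAutomaton.Iso
          (stallingsAutomaton w ((FreeTimesAbelian.proj (H₁ ⊓ H₂)).subgroupOf
            (FreeTimesAbelian.proj H₁ ⊓ FreeTimesAbelian.proj H₂)))
          (cayleyMultidigraph fun j => Multiplicative.ofAdd (σ.rowQ j))) := by
  refine ⟨FreeTimesAbelian.nonempty_subgroupBasis hH₁, FreeTimesAbelian.nonempty_subgroupBasis hH₂,
    FreeGroup.exists_basis_of_fg
      (FreeGroup.fg_inf (FreeTimesAbelian.proj_fg hH₁) (FreeTimesAbelian.proj_fg hH₂)),
    fun β₁ β₂ r w => ⟨SmithDecomposition.nonempty _, fun σ => ⟨σ.closure_rowQ, ?_⟩⟩⟩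
  set K := (FreeTimesAbelian.proj (H₁ ⊓ H₂)).subgroupOf
    (FreeTimesAbelian.proj H₁ ⊓ FreeTimesAbelian.proj H₂) with hK
  let θ : ↥(FreeTimesAbelian.proj H₁ ⊓ FreeTimesAbelian.proj H₂) →* Multiplicative σ.cyclicSum :=
    σ.toCyclicSum.toMultiplicative.comp (FreeTimesAbelian.abelianizeBasis w)
  have hθ : Function.Surjective θ := by
    have h₁ : Function.Surjective σ.toCyclicSum.toMultiplicative := σ.toCyclicSum_surjective
    exact h₁.comp (FreeTimesAbelian.abelianizeBasis_surjective w)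
  have hker : θ.ker = K := by
    ext g
    rw [hK, Subgroup.mem_subgroupOf, FreeTimesAbelian.mem_proj_inf_iff β₁ β₂ w,
      ← σ.toCyclicSum_eq_zero_iff]
    exact Iff.rfl
  -- Normality holds in H₁π ∩ H₂π only because K is a kernel there; together with nontriviality it
  -- makes every vertex a core vertex.
  have hn : K.Normal := hker ▸ MonoidHom.normal_ker θ
  have hK0 : K ≠ ⊥ := by
    intro h
    rw [hK, Subgroup.subgroupOf_eq_bot, disjoint_iff,
      inf_eq_left.mpr FreeTimesAbelian.proj_inf_le] at h
    exact hne h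
  refine ⟨(XAutomaton.coreIso (isCoreVertex_schreierAutomaton w K hK0)).trans
    (schreierIsoCayley w K θ hθ hker _ fun j => ?_)⟩
  change Multiplicative.ofAdd (σ.toCyclicSum (FreeTimesAbelian.abelianizeBasis w (w j)).toAdd) = _
  rw [FreeTimesAbelian.abelianizeBasis_apply, toAdd_ofAdd, σ.toCyclicSum_single]
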